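/- Let $d\ge 0$ and let $\Omega\subset\mathbb R^d$ be a bounded open set with the following property (satisfied e.g. by convex sets and by bounded Lipschitz domains): there are $\delta>0$ and $K\ge 0$ such that any $x,\hat x\in\Omega$ with $|x-\hat x|<\delta$ can be joined by a curve in $\Omega$ of length at most $K|x-\hat x|$. Let $\mathbb T^d=\mathbb R^d/\mathbb Z^d$, and let $r,Q>0$. Then there is a constant $C=C(\Omega,r,Q,d)$ such that the following holds for every $A\in C^1(\Omega\times\mathbb T^d;\mathbb R^{d\times d})$ (i.e. $A(x,\lambda)$ is $1$-periodic in each coordinate of $\lambda\in\mathbb R^d$) for which - $A(x,\lambda)$ is symmetric and $\langle A(x,\lambda)\xi,\xi\rangle\ge r|\xi|^2$ for all $x\in\Omega$, $\lambda\in\mathbb T^d$, $\xi\in\mathbb R^d$; - the mixed partial derivatives $\partial_{x_k}\partial_{\lambda_l}A_{ij}$ exist on $\Omega\times\mathbb T^d$, and $|A_{ij}|$, $|\partial_{x_k}A_{ij}|$, $|\partial_{\lambda_k}A_{ij}|$, $|\partial_{x_k}\partial_{\lambda_l}A_{ij}|$ are all bounded by $Q$ on $\Omega\times\mathbb T^d$,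 for all $i,j,k,l$. For $x\in\Omega$, the corrector $\chi(\cdot;x)=(\chi_1,\dots,\chi_d)$, with $\chi_l(\cdot;x)\in H^1(\mathbb T^d)$, is a weak solution of the cell problems $$-\nabla_\lambda\cdot\big(A(x,\lambda)\nabla_\lambda\chi_l(\lambda;x)\big)=\nabla_\lambda\cdot a_l(x,\lambda)\quad\text{on }\mathbb T^d,\qquad 1\le l\le d,$$ where $a_l$ is the $l$-th column of $A$; that is, $\int_{\mathbb T^d}A\nabla_\lambda\chi_l\cdot\nabla v\,d\lambda=-\int_{\mathbb T^d}a_l\cdot\nabla v\,d\lambda$ for all $v\in H^1(\mathbb T^d)$. The homogenized tensor is $$\overline A(x)=(\mathcal HA)(x)=\int_{\mathbb T^d}\big(A(x,\lambda)+A(x,\lambda)\,\nabla_\lambda\chi(\lambda;x)^T\big)\,d\lambda,\qquad (\nabla_\lambda\chi)_{ij}=\partial_{\lambda_j}\chi_i .$$ 1. For every $x\in\Omega$ a corrector $\chi(\cdot;x)$ exists. 2. For all $x,\hat x\in\Omega$, all correctors $\chi(\cdot;x)$, $\chi(\cdot;\hat x)$ and all $1\le l\le d$, $\ \|\nabla_\lambda\chi_l(\cdot;x)-\nabla_\lambda\chi_l(\cdot;\hat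 x)\|_{L^2(\mathbb T^d)}\le C|x-\hat x|$. In particular (take $\hat x=x$) $\nabla_\lambda\chi(\cdot;x)$, and hence $\overline A(x)$, does not depend on the choice of the corrector. 3. $\overline A$ is Lipschitz in the spectral norm: $\|\overline A(x)-\overline A(\hat x)\|_2\le C|x-\hat x|$ for all $x,\hat x\in\Omega$. -/

import Mathlib

open scoped NNReal

namespace Homogenization

/-- Euclidean space of dimension `d`. -/
abbrev Eucl (d : ℕ) : Type := EuclideanSpace ℝ (Fin d)

/-- Real `d × d` matrices. -/
abbrev Mat (d : ℕ) : Type := Matrix (Fin d) (Fin d) ℝ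

/-- The `i`-th standard basis vector. -/
noncomputable def stdVec {d : ℕ} (i : Fin d) : Eucl d := EuclideanSpace.single i (1 : ℝ)

/-- The partial derivative of `f` at `y` in the direction of the `k`-th coordinate. -/
noncomputable def partialDeriv {d : ℕ} (k : Fin d) (f : Eucl d → ℝ) (y : Eucl d) : ℝ :=
  lineDeriv ℝ f y (stdVec k)

/-- `f` is 1-periodic in each coordinate: it is a function on the torus `ℝᵈ / ℤᵈ`. -/
def IsPeriodic {d : ℕ} {β : Type*} (f : Eucl d → β) : Prop :=
  ∀ (i : Fin d) (y : Eucl d), f (y + stdVec i) = f y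

/-- The half-open unit cube, a fundamental domain of the torus `ℝᵈ / ℤᵈ`. -/
def unitCube (d : ℕ) : Set (Eucl d) := {y | ∀ i, y i ∈ Set.Ico (0 : ℝ) 1}

/-- Integration over the torus: Lebesgue measure on the unit cube. -/
noncomputable def torusMeasure (d : ℕ) : MeasureTheory.Measure (Eucl d) :=
  MeasureTheory.volume.restrict (unitCube d)

/-- The spectral norm `sup_{ξ ≠ 0} |B ξ| / |ξ|` of a matrix: its operator norm on Euclidean space. -/
noncomputable def matSpectralNorm {d : ℕ} (B : Mat d) : ℝ :=
  ‖Matrix.toEuclideanCLM (n := Fin d) (𝕜 := ℝ) B‖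

/-- `u` belongs to the periodic Sobolev space `H¹` of the torus and `g` is its weak gradient:
both are periodic and square integrable over a period, and integration by parts holds against
every smooth periodic test function. -/
structure HasTorusWeakGradient {d : ℕ} (u : Eucl d → ℝ) (g : Eucl d → Eucl d) : Prop where
  periodic : IsPeriodic u
  periodic_grad : IsPeriodic g
  memLp : MeasureTheory.MemLp u 2 (torusMeasure d)
  memLp_grad : MeasureTheory.MemLp g 2 (torusMeasure d)
  integral_by_parts : ∀ φ : Eucl d → ℝ, ContDiff ℝ ((⊤ : ℕ∞) : WithTop ℕ∞) φ → IsPeriodic φ →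
    ∀ k : Fin d, ∫ y, u y * partialDeriv k φ y ∂(torusMeasure d)
      = -∫ y, g y k * φ y ∂(torusMeasure d)

/-- `χ = (χ₁, …, χ_d)`, with weak gradients `G = (∇χ₁, …, ∇χ_d)`, is a solution of the cell
problem of the periodic coefficient matrix `B`: for each `l`, `χ_l ∈ H¹` of the torus is a weak
solution of `-∇ · (B ∇χ_l) = ∇ · b_l`, where `b_l` is the `l`-th column of `B`. No additive
constant is fixed. -/
structure IsCorrector {d : ℕ} (B : Eucl d → Mat d) (χ : Fin d → Eucl d → ℝ)
    (G : Fin d → Eucl d → Eucl d) : Prop where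
  weakGradient : ∀ l, HasTorusWeakGradient (χ l) (G l)
  weakForm : ∀ l, ∀ (v : Eucl d → ℝ) (h : Eucl d → Eucl d), HasTorusWeakGradient v h →
    ∫ y, (∑ i, ∑ k, B y i k * G l y k * h y i) ∂(torusMeasure d)
      = -∫ y, (∑ i, B y i l * h y i) ∂(torusMeasure d)

/-- The Jacobian `(∇χ)_{ij} = ∂_j χ_i` at `y`, read off from the gradients of the components. -/
def jacobian {d : ℕ} (G : Fin d → Eucl d → Eucl d) (y : Eucl d) : Mat d :=
  Matrix.of fun i j => G i y j

open Classical in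
/-- The gradients of a solution of the cell problem of `B` (zero if there is no solution). -/
noncomputable def correctorGradient {d : ℕ} (B : Eucl d → Mat d) : Fin d → Eucl d → Eucl d :=
  if h : ∃ G : Fin d → Eucl d → Eucl d, ∃ χ, IsCorrector B χ G then h.choose else fun _ _ => 0

/-- The homogenized tensor `∫ (A(x,y) + A(x,y) ∇χ(y;x)ᵀ) dy` (integral over the torus, taken
entrywise), where `χ(·;x)` solves the cell problem of `A(x,·)`. -/
noncomputable def homogenizedTensor {d : ℕ} (A : Eucl d → Eucl d → Mat d) (x : Eucl d) : Mat d :=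
  Matrix.of fun i j =>
    ∫ y, (A x y + A x y * (jacobian (correctorGradient (A x)) y).transpose) i j ∂(torusMeasure d)

/-- Any two points of `Ω` at distance less than some `δ > 0` are joined by a curve inside `Ω`
whose length is at most a fixed multiple of their distance (the curve is parametrized on `[0,1]`
with Lipschitz constant `K |x - y|`). Convex sets and bounded Lipschitz domains are of this kind. -/
def IsUniformlyLocallyQuasiconvex {d : ℕ} (Ω : Set (Eucl d)) : Prop :=
  ∃ δ : ℝ, 0 < δ ∧ ∃ K : ℝ≥0, ∀ x ∈ Ω, ∀ y ∈ Ω, dist x y < δ →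
    ∃ γ : ℝ → Eucl d, γ 0 = x ∧ γ 1 = y ∧ Set.MapsTo γ (Set.Icc 0 1) Ω ∧
      LipschitzOnWith (K * nndist x y) γ (Set.Icc 0 1)

/-- The assumptions on the coefficient field `A(x,y)`, for `x ∈ Ω` and `y` on the torus. -/
structure IsAdmissibleCoefficient {d : ℕ} (Ω : Set (Eucl d)) (r Q : ℝ)
    (A : Eucl d → Eucl d → Mat d) : Prop where
  periodic : ∀ x ∈ Ω, IsPeriodic (A x)
  contDiff : ∀ i j, ContDiffOn ℝ 1 (fun p : Eucl d × Eucl d => A p.1 p.2 i j) (Ω ×ˢ Set.univ)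
  symm : ∀ x ∈ Ω, ∀ y, (A x y).IsSymm
  elliptic : ∀ x ∈ Ω, ∀ y ξ : Eucl d,
    r * ‖ξ‖ ^ 2 ≤ inner ℝ (Matrix.toEuclideanCLM (n := Fin d) (𝕜 := ℝ) (A x y) ξ) ξ
  bound : ∀ x ∈ Ω, ∀ y i j, |A x y i j| ≤ Q
  bound_dx : ∀ x ∈ Ω, ∀ y i j k, |partialDeriv k (fun x' => A x' y i j) x| ≤ Q
  bound_dy : ∀ x ∈ Ω, ∀ y i j k, |partialDeriv k (fun y' => A x y' i j) y| ≤ Q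
  exists_dxdy : ∀ x ∈ Ω, ∀ y i j k l, LineDifferentiableAt ℝ
    (fun x' => partialDeriv l (fun y' => A x' y' i j) y) x (stdVec k)
  bound_dxdy : ∀ x ∈ Ω, ∀ y i j k l,
    |partialDeriv k (fun x' => partialDeriv l (fun y' => A x' y' i j) y) x| ≤ Q

end Homogenization

namespace Homogenization

/-! Since `a_l = A e_l`, the cell problem says that `A (e_l + ∇χ_l)` is orthogonal in `L²` to the
space `W` of all gradients on the torus. With `T` the operator of multiplication by `A(x,·)`, this
reads: find `g ∈ W` with `⟪T (e_l + g), h⟫ = 0` for all `h ∈ W`. Ellipticity makes `T` coercive, so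
Lax–Milgram applies once `W` is closed (`isClosed_gradientSpace`). Closedness follows from the
Poincaré inequality for mean-free functions, proved by Parseval and comparison of Fourier modes.

For two operators `T`, `T'` the difference `g - g'` solves the problem of `T` with data `(T - T') (e
+ g')`. Hence `‖g - g'‖` is bounded by `‖T - T'‖` times a constant depending on `r`, `Q` and `d`
(`norm_sub_le_of_inner_map_add_eq_zero`). The entries of the homogenized tensor are `⟪T (e_j + g_j),
e_i⟫`, so they inherit the bound.

It remains that `A(x,·)` is Lipschitz in `x`, uniformly in the torus variable: the bound on `∂ₓA` is
integrated along short curves in `Ω`, and the bound on `A` itself handles distant points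
(`IsUniformlyLocallyQuasiconvex.exists_lipschitz`). -/

open MeasureTheory

/-! ### The torus as unit cube and as product of circles -/

theorem unitCube_eq_preimage (d : ℕ) :
    unitCube d = (WithLp.ofLp : Eucl d → Fin d → ℝ) ⁻¹'
      (Set.univ.pi fun _ => Set.Ico (0 : ℝ) 1) := by
  ext y
  simp [unitCube]

theorem measurableSet_unitCube (d : ℕ) : MeasurableSet (unitCube d) := by
  rw [unitCube_eq_preimage]
  exact (WithLp.measurable_ofLp 2 _) (MeasurableSet.univ_pi fun _ => measurableSet_Ico)

theorem ae_mem_unitCube (d : ℕ) : ∀ᵐ y ∂(torusMeasure d), y ∈ unitCube d :=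
  ae_restrict_mem (measurableSet_unitCube d)

theorem measurePreserving_ofLp_torusMeasure (d : ℕ) :
    MeasurePreserving (WithLp.ofLp : Eucl d → Fin d → ℝ) (torusMeasure d)
      (Measure.pi fun _ : Fin d => (volume : Measure ℝ).restrict (Set.Ioc 0 (0 + 1))) := by
  have h := (PiLp.volume_preserving_ofLp (Fin d)).restrict_preimage
    (s := Set.univ.pi fun _ => Set.Ico (0 : ℝ) 1) (MeasurableSet.univ_pi fun _ => measurableSet_Ico)
  rw [← unitCube_eq_preimage, volume_pi, Measure.restrict_pi_pi] at h
  simpa only [zero_add, torusMeasure, restrict_Ico_eq_restrict_Ioc] using h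

/-- The projection of Euclidean space to the torus as a product of circles. -/
def toTorus {d : ℕ} (y : Eucl d) : UnitAddTorus (Fin d) := fun i => (y i : UnitAddCircle)

/-- The representative in the unit cube of a point of the torus. -/
noncomputable def ofTorus {d : ℕ} (t : UnitAddTorus (Fin d)) : Eucl d :=
  WithLp.toLp 2 fun i => (AddCircle.equivIco (1 : ℝ) 0 (t i) : ℝ)

theorem ofTorus_toTorus {d : ℕ} {y : Eucl d} (hy : y ∈ unitCube d) : ofTorus (toTorus y) = y := by
  ext i
  have : y i ∈ Set.Ico (0 : ℝ) (0 + 1) := by simpa using hy i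
  exact congrArg Subtype.val ((AddCircle.equivIco (1 : ℝ) 0).apply_symm_apply ⟨y i, this⟩)

/-- The Haar probability measure on the product of circles. -/
noncomputable def haarTorus (d : ℕ) : Measure (UnitAddTorus (Fin d)) :=
  Measure.pi fun _ => AddCircle.haarAddCircle

theorem measurePreserving_toTorus (d : ℕ) :
    MeasurePreserving (toTorus (d := d)) (torusMeasure d) (haarTorus d) := by
  have h1 : MeasurePreserving ((↑) : ℝ → UnitAddCircle)
      ((volume : Measure ℝ).restrict (Set.Ioc 0 (0 + 1))) AddCircle.haarAddCircle := by
    have := AddCircle.measurePreserving_mk 1 0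
    rwa [AddCircle.volume_eq_smul_haarAddCircle, ENNReal.ofReal_one, one_smul] at this
  exact (measurePreserving_pi _ _ fun _ => h1).comp (measurePreserving_ofLp_torusMeasure d)

instance (d : ℕ) : IsProbabilityMeasure (torusMeasure d) :=
  ⟨by
    have : IsProbabilityMeasure (haarTorus d) := by unfold haarTorus; infer_instance
    rw [← Set.preimage_univ (f := toTorus), (measurePreserving_toTorus d).measure_preimage
      MeasurableSet.univ.nullMeasurableSet, measure_univ]⟩

theorem measurable_ofTorus (d : ℕ) : Measurable (ofTorus (d := d)) := by
  refine (WithLp.measurable_toLp 2 _).comp (measurable_pi_lambda _ fun i => ?_)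
  exact measurable_subtype_coe.comp
    ((AddCircle.measurableEquivIco 1 0).measurable.comp (measurable_pi_apply i))

theorem measurePreserving_ofTorus (d : ℕ) :
    MeasurePreserving (ofTorus (d := d)) (haarTorus d) (torusMeasure d) := by
  refine ⟨measurable_ofTorus d, ?_⟩
  rw [← (measurePreserving_toTorus d).map_eq,
    Measure.map_map (measurable_ofTorus d) (measurePreserving_toTorus d).measurable]
  have : ofTorus ∘ toTorus =ᵐ[torusMeasure d] id := by
    filter_upwards [ae_mem_unitCube d] with y hy using ofTorus_toTorus hy
  rw [Measure.map_congr this, Measure.map_id]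

/-! ### Fourier series and the Poincaré inequality -/

/-- The phase `2π k · y` of the Fourier mode with index `k`. -/
noncomputable def phase {d : ℕ} (k : Fin d → ℤ) (y : Eucl d) : ℝ :=
  2 * Real.pi * ∑ i, (k i : ℝ) * y i

theorem mFourier_toTorus {d : ℕ} (k : Fin d → ℤ) (y : Eucl d) :
    UnitAddTorus.mFourier k (toTorus y) = Complex.exp (phase k y * Complex.I) := by
  simp only [UnitAddTorus.mFourier, ContinuousMap.coe_mk, toTorus, fourier_coe_apply, phase]
  rw [← Complex.exp_sum]
  congr 1
  push_cast
  rw [Finset.mul_sum, Finset.sum_mul]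
  refine Finset.sum_congr rfl fun i _ => ?_
  ring

theorem continuous_phase {d : ℕ} (k : Fin d → ℤ) : Continuous (phase k) := by
  unfold phase
  fun_prop

/-- Parseval on the product of circles, transported to the cube. For real `u` the squared modulus of
a Fourier coefficient splits into a cosine and a sine part, which suit real-valued test functions.
-/
theorem hasSum_fourier_sq {d : ℕ} {u : Eucl d → ℝ} (hu : MemLp u 2 (torusMeasure d)) :
    HasSum (fun k : Fin d → ℤ => (∫ y, u y * Real.cos (phase k y) ∂(torusMeasure d)) ^ 2 +
      (∫ y, u y * Real.sin (phase k y) ∂(torusMeasure d)) ^ 2)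
      (∫ y, u y ^ 2 ∂(torusMeasure d)) := by
  have hint : Integrable u (torusMeasure d) := hu.integrable (by norm_num)
  have hv : MemLp (fun t => ((u (ofTorus t) : ℝ) : ℂ)) 2 (haarTorus d) :=
    (hu.comp_measurePreserving (measurePreserving_ofTorus d)).ofReal
  have hmeas := hv.aestronglyMeasurable
  have key := UnitAddTorus.hasSum_sq_mFourierCoeff (d := Fin d) hv.toLp
  have htransfer : ∀ {E : Type} [NormedAddCommGroup E] [NormedSpace ℝ E]
      (F : UnitAddTorus (Fin d) → E), AEStronglyMeasurable F (haarTorus d) →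
      ∫ t, F t ∂(haarTorus d) = ∫ y, F (toTorus y) ∂(torusMeasure d) := by
    intro E _ _ F hF
    rw [← (measurePreserving_toTorus d).map_eq] at hF ⊢
    exact integral_map (measurePreserving_toTorus d).measurable.aemeasurable hF
  have hcongr := hv.coeFn_toLp
  have hr : ∫ t, ‖(hv.toLp : UnitAddTorus (Fin d) → ℂ) t‖ ^ 2 ∂(haarTorus d) =
      ∫ y, u y ^ 2 ∂(torusMeasure d) := by
    rw [integral_congr_ae (g := fun t => ‖((u (ofTorus t) : ℝ) : ℂ)‖ ^ 2)
      (hcongr.mono fun t ht => by simp only [ht]), htransfer (fun t => ‖((u (ofTorus t) : ℝ) : ℂ)‖ ^ 2) (hmeas.norm.pow 2)]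
    refine integral_congr_ae ?_
    filter_upwards [ae_mem_unitCube d] with y hy
    simp [ofTorus_toTorus hy]
  have hl : ∀ k, ‖UnitAddTorus.mFourierCoeff (hv.toLp : UnitAddTorus (Fin d) → ℂ) k‖ ^ 2 =
      (∫ y, u y * Real.cos (phase k y) ∂(torusMeasure d)) ^ 2 +
      (∫ y, u y * Real.sin (phase k y) ∂(torusMeasure d)) ^ 2 := by
    intro k
    have hcos : Integrable (fun y => u y * Real.cos (phase k y)) (torusMeasure d) :=
      hint.mul_bdd (c := 1)
        (Real.continuous_cos.comp (continuous_phase k)).aestronglyMeasurable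
        (.of_forall fun y => by simpa using Real.abs_cos_le_one _)
    have hsin : Integrable (fun y => u y * Real.sin (phase k y)) (torusMeasure d) :=
      hint.mul_bdd (c := 1)
        (Real.continuous_sin.comp (continuous_phase k)).aestronglyMeasurable
        (.of_forall fun y => by simpa using Real.abs_sin_le_one _)
    have : UnitAddTorus.mFourierCoeff (hv.toLp : UnitAddTorus (Fin d) → ℂ) k =
        ((∫ y, u y * Real.cos (phase k y) ∂(torusMeasure d) : ℝ) : ℂ) -
        ((∫ y, u y * Real.sin (phase k y) ∂(torusMeasure d) : ℝ) : ℂ) * Complex.I := by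
      calc _ = ∫ t, UnitAddTorus.mFourier (-k) t • ((u (ofTorus t) : ℝ) : ℂ) ∂(haarTorus d) :=
            integral_congr_ae (hcongr.mono fun t ht => by simp only [ht])
        _ = ∫ y, (((u y * Real.cos (phase k y) : ℝ) : ℂ) -
              ((u y * Real.sin (phase k y) : ℝ) : ℂ) * Complex.I) ∂(torusMeasure d) := by
            rw [htransfer (fun t => UnitAddTorus.mFourier (-k) t • ((u (ofTorus t) : ℝ) : ℂ))
              ((UnitAddTorus.mFourier (-k)).continuous.aestronglyMeasurable.smul hmeas)]
            refine integral_congr_ae ?_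
            filter_upwards [ae_mem_unitCube d] with y hy
            have hneg : phase (-k) y = -phase k y := by simp [phase]
            rw [ofTorus_toTorus hy, mFourier_toTorus, hneg, Complex.exp_mul_I, smul_eq_mul]
            push_cast
            rw [Complex.cos_neg, Complex.sin_neg]
            ring
        _ = _ := by
            rw [integral_sub hcos.ofReal (hsin.ofReal.mul_const _), integral_mul_const,
              integral_complex_ofReal, integral_complex_ofReal]
    rw [this, ← Complex.normSq_eq_norm_sq, Complex.normSq_apply]
    simp
    ring
  have key' : HasSum (fun k => ‖UnitAddTorus.mFourierCoeff
      (hv.toLp : UnitAddTorus (Fin d) → ℂ) k‖ ^ 2) (∫ y, u y ^ 2 ∂(torusMeasure d)) := hr ▸ key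
  simpa only [hl] using key'

theorem hasDerivAt_phase_line {d : ℕ} (k : Fin d → ℤ) (j : Fin d) (y : Eucl d) (t : ℝ) :
    HasDerivAt (fun t : ℝ => phase k (y + t • stdVec j)) (2 * Real.pi * k j) t := by
  have : (fun t : ℝ => phase k (y + t • stdVec j)) =
      fun t => phase k y + t * (2 * Real.pi * k j) := by
    funext t
    simp only [phase, stdVec, PiLp.add_apply, PiLp.smul_apply, smul_eq_mul, mul_add,
      Finset.sum_add_distrib, PiLp.single_apply]
    simp
    ring
  rw [this]
  simpa using ((hasDerivAt_id t).mul_const (2 * Real.pi * (k j : ℝ))).const_add (phase k y)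

theorem phase_add_stdVec {d : ℕ} (k : Fin d → ℤ) (j : Fin d) (y : Eucl d) :
    phase k (y + stdVec j) = phase k y + k j * (2 * Real.pi) := by
  simp only [phase, stdVec, PiLp.add_apply, mul_add, Finset.sum_add_distrib,
    PiLp.single_apply]
  simp
  ring

theorem contDiff_phase {d : ℕ} (k : Fin d → ℤ) :
    ContDiff ℝ ((⊤ : ℕ∞) : WithTop ℕ∞) (phase k) := by
  unfold phase
  fun_prop

theorem partialDeriv_cos_phase {d : ℕ} (k : Fin d → ℤ) (j : Fin d) (y : Eucl d) :
    partialDeriv j (fun y => Real.cos (phase k y)) y =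
      -(2 * Real.pi * k j) * Real.sin (phase k y) := by
  have h := (hasDerivAt_phase_line k j y 0).cos.deriv
  simp only [zero_smul, add_zero] at h
  rw [partialDeriv, lineDeriv, h]
  ring

theorem partialDeriv_sin_phase {d : ℕ} (k : Fin d → ℤ) (j : Fin d) (y : Eucl d) :
    partialDeriv j (fun y => Real.sin (phase k y)) y =
      (2 * Real.pi * k j) * Real.cos (phase k y) := by
  have h := (hasDerivAt_phase_line k j y 0).sin.deriv
  simp only [zero_smul, add_zero] at h
  rw [partialDeriv, lineDeriv, h]
  ring

theorem memLp_coord {d : ℕ} {μ : Measure (Eucl d)} {g : Eucl d → Eucl d} (hg : MemLp g 2 μ)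
    (j : Fin d) : MemLp (fun y => g y j) 2 μ :=
  (EuclideanSpace.proj (𝕜 := ℝ) j).comp_memLp' hg

/-- The Fourier coefficients of a weak partial derivative. -/
theorem HasTorusWeakGradient.fourier_sq {d : ℕ} {u : Eucl d → ℝ} {g : Eucl d → Eucl d}
    (h : HasTorusWeakGradient u g) (k : Fin d → ℤ) (j : Fin d) :
    (∫ y, g y j * Real.cos (phase k y) ∂(torusMeasure d)) ^ 2 +
      (∫ y, g y j * Real.sin (phase k y) ∂(torusMeasure d)) ^ 2 =
    (2 * Real.pi * k j) ^ 2 * ((∫ y, u y * Real.cos (phase k y) ∂(torusMeasure d)) ^ 2 +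
      (∫ y, u y * Real.sin (phase k y) ∂(torusMeasure d)) ^ 2) := by
  -- Testing with the cosine gives `2π k_j` times the sine coefficient of `u`, testing with the sine
  -- gives `-2π k_j` times its cosine coefficient; the sum of squares absorbs swap and sign.
  have hc := h.integral_by_parts (fun y => Real.cos (phase k y))
    (Real.contDiff_cos.comp (contDiff_phase k))
    (fun i y => by simp only [phase_add_stdVec, Real.cos_add_int_mul_two_pi]) j
  have hs := h.integral_by_parts (fun y => Real.sin (phase k y))
    (Real.contDiff_sin.comp (contDiff_phase k))
    (fun i y => by simp only [phase_add_stdVec, Real.sin_add_int_mul_two_pi]) j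
  simp only [partialDeriv_cos_phase, partialDeriv_sin_phase, mul_left_comm (u _) _ _,
    integral_const_mul] at hc hs
  rw [← neg_eq_iff_eq_neg] at hc hs
  rw [← hc, ← hs]
  ring

/-- **Poincaré inequality** on the torus. -/
theorem HasTorusWeakGradient.poincare {d : ℕ} {u : Eucl d → ℝ} {g : Eucl d → Eucl d}
    (h : HasTorusWeakGradient u g) (hu : ∫ y, u y ∂(torusMeasure d) = 0) :
    ∫ y, u y ^ 2 ∂(torusMeasure d) ≤ ∫ y, ‖g y‖ ^ 2 ∂(torusMeasure d) := by
  have hsum := hasSum_sum (s := Finset.univ) fun j _ =>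
    hasSum_fourier_sq (memLp_coord h.memLp_grad j)
  have hnorm : ∫ y, ‖g y‖ ^ 2 ∂(torusMeasure d) =
      ∑ j, ∫ y, g y j ^ 2 ∂(torusMeasure d) := by
    rw [← integral_finsetSum _ fun j _ => (memLp_coord h.memLp_grad j).integrable_sq]
    simp only [EuclideanSpace.real_norm_sq_eq]
  rw [hnorm]
  refine hasSum_le (fun k => ?_) (hasSum_fourier_sq h.memLp) hsum
  simp only [h.fourier_sq, ← Finset.sum_mul]
  -- The zero mode of `u` vanishes by `hu`. A nonzero `k` has an integer coordinate with `k_j² ≥ 1`,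
  -- so the factor `∑ (2π k_j)²` is at least `1`.
  by_cases hk : k = 0
  · subst hk
    simp [phase, hu]
  · obtain ⟨j, hj⟩ := Function.ne_iff.1 hk
    refine le_mul_of_one_le_left (by positivity) ?_
    have h1 : (1 : ℝ) ≤ (k j : ℝ) ^ 2 := by
      have : (1 : ℤ) ≤ k j ^ 2 := Int.add_one_le_of_lt (sq_pos_of_ne_zero hj)
      exact_mod_cast this
    have h2 : (1 : ℝ) ≤ (2 * Real.pi) ^ 2 := by nlinarith [Real.pi_gt_three]
    calc (1 : ℝ) ≤ (2 * Real.pi * k j) ^ 2 := by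
          rw [mul_pow]; exact one_le_mul_of_one_le_of_one_le h2 h1
      _ ≤ _ := Finset.single_le_sum (f := fun j => (2 * Real.pi * (k j : ℝ)) ^ 2)
        (fun _ _ => sq_nonneg _) (Finset.mem_univ j)

/-! ### Test functions and calculus of weak gradients -/

theorem memLp_torusMeasure_of_continuous {d : ℕ} {E : Type*} [NormedAddCommGroup E]
    {F : Eucl d → E} (hF : Continuous F) : MemLp F 2 (torusMeasure d) := by
  have hK : IsCompact ((WithLp.toLp 2 : (Fin d → ℝ) → Eucl d) ''
      Set.univ.pi fun _ => Set.Icc (0 : ℝ) 1) :=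
    (isCompact_univ_pi fun _ => isCompact_Icc).image (PiLp.continuous_toLp 2 _)
  obtain ⟨C, hC⟩ := hK.exists_bound_of_continuousOn hF.continuousOn
  refine MemLp.of_bound hF.aestronglyMeasurable C ?_
  filter_upwards [ae_mem_unitCube d] with y hy
  exact hC y ⟨WithLp.ofLp y, fun i _ => Set.Ico_subset_Icc_self (hy i), rfl⟩

theorem continuous_partialDeriv {d : ℕ} {φ : Eucl d → ℝ}
    (hφ : ContDiff ℝ ((⊤ : ℕ∞) : WithTop ℕ∞) φ) (k : Fin d) : Continuous (partialDeriv k φ) := by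
  have : partialDeriv k φ = fun y => fderiv ℝ φ y (stdVec k) := by
    funext y
    exact (hφ.differentiable (by simp) y).lineDeriv_eq_fderiv
  rw [this]
  exact (hφ.continuous_fderiv (by simp)).clm_apply continuous_const

/-- The partial derivatives of a smooth periodic function have mean zero. -/
theorem integral_partialDeriv_eq_zero {d : ℕ} {φ : Eucl d → ℝ}
    (hφ : ContDiff ℝ ((⊤ : ℕ∞) : WithTop ℕ∞) φ) (hper : IsPeriodic φ) (k : Fin d) :
    ∫ y, partialDeriv k φ y ∂(torusMeasure d) = 0 := by
  obtain ⟨n, rfl⟩ : ∃ n, d = n + 1 := ⟨d - 1, by have := k.pos; omega⟩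
  have hφd := hφ.differentiable (by simp)
  let e : (Fin (n + 1) → ℝ) →L[ℝ] Eucl (n + 1) :=
    (EuclideanSpace.equiv (Fin (n + 1)) ℝ).symm.toContinuousLinearMap
  -- The divergence theorem is applied to the field whose only nonzero component is the `k`-th,
  -- equal to `φ`; its divergence is `∂ₖφ`.
  let f : Fin (n + 1) → (Fin (n + 1) → ℝ) → ℝ := fun i => if i = k then φ ∘ e else 0
  let f' : Fin (n + 1) → (Fin (n + 1) → ℝ) → (Fin (n + 1) → ℝ) →L[ℝ] ℝ :=
    fun i z => if i = k then (fderiv ℝ φ (e z)).comp e else 0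
  have hek : e (Pi.single k 1) = stdVec k := rfl
  have hsum : ∀ z, ∑ i, f' i z (Pi.single i 1) = partialDeriv k φ (e z) := by
    intro z
    rw [Finset.sum_eq_single k (fun i _ hi => by simp [f', hi]) (by simp)]
    simp only [f', if_true, ContinuousLinearMap.comp_apply, hek]
    exact ((hφd _).lineDeriv_eq_fderiv).symm
  have hcont : Continuous fun z => partialDeriv k φ (e z) :=
    (continuous_partialDeriv hφ k).comp e.continuous
  have key := integral_divergence_of_hasFDerivAt_off_countable' (0 : Fin (n + 1) → ℝ) 1
    zero_le_one f f' ∅ Set.countable_empty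
    (fun i => by
      by_cases hi : i = k
      · simp only [f, hi, if_true]; exact (hφ.continuous.comp e.continuous).continuousOn
      · simp only [f, hi, if_false]; exact continuousOn_const)
    (fun z _ i => by
      by_cases hi : i = k
      · simp only [f, f', hi, if_true]
        exact (hφd (e z)).hasFDerivAt.comp z e.hasFDerivAt
      · simp only [f, f', hi, if_false]; exact hasFDerivAt_const _ _)
    (by simp only [hsum]; exact hcont.continuousOn.integrableOn_Icc)
  simp only [hsum] at key
  have htransfer : ∫ y, partialDeriv k φ y ∂(torusMeasure (n + 1)) =
      ∫ z in Set.Icc (0 : Fin (n + 1) → ℝ) 1, partialDeriv k φ (e z) := by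
    rw [volume_pi, ← setIntegral_congr_set Measure.univ_pi_Ico_ae_eq_Icc, torusMeasure,
      unitCube_eq_preimage]
    exact (PiLp.volume_preserving_ofLp (Fin (n + 1))).setIntegral_preimage_emb
      (MeasurableEquiv.toLp 2 _).symm.measurableEmbedding (fun z => partialDeriv k φ (e z)) _
  rw [htransfer, key]
  refine Finset.sum_eq_zero fun i _ => ?_
  by_cases hi : i = k
  · subst hi
    -- The two faces orthogonal to direction `k` differ by the translation `stdVec k`, so by
    -- periodicity their contributions cancel.
    rw [sub_eq_zero]
    refine integral_congr_ae (.of_forall fun z => ?_)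
    simp only [f, if_true, Function.comp_apply, Pi.one_apply, Pi.zero_apply]
    rw [← hper i (e (i.insertNth 0 z))]
    congr 1
    rw [← hek, ← map_add]
    congr 1
    refine (Fin.eq_insertNth_iff.2 ⟨by simp, ?_⟩).symm
    ext j
    simp [Fin.removeNth]
  · simp [f, hi]

/-- The representative of a point modulo `ℤᵈ` in the unit cube. -/
noncomputable def fractCube {d : ℕ} (y : Eucl d) : Eucl d :=
  WithLp.toLp 2 fun i => Int.fract (y i)

theorem fractCube_eq_self {d : ℕ} {y : Eucl d} (hy : y ∈ unitCube d) : fractCube y = y := by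
  ext i
  exact Int.fract_eq_self.2 (hy i)

theorem isPeriodic_comp_fractCube {d : ℕ} {β : Type*} (f : Eucl d → β) :
    IsPeriodic fun y => f (fractCube y) := by
  intro i y
  refine congrArg f ?_
  ext j
  by_cases h : j = i
  · simp [fractCube, stdVec, h]
  · simp [fractCube, stdVec, h]

theorem comp_fractCube_ae_eq {d : ℕ} {β : Type*} (f : Eucl d → β) :
    (fun y => f (fractCube y)) =ᵐ[torusMeasure d] f := by
  filter_upwards [ae_mem_unitCube d] with y hy
  rw [fractCube_eq_self hy]

theorem HasTorusWeakGradient.sub {d : ℕ} {u v : Eucl d → ℝ} {g h : Eucl d → Eucl d}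
    (hu : HasTorusWeakGradient u g) (hv : HasTorusWeakGradient v h) :
    HasTorusWeakGradient (fun y => u y - v y) (fun y => g y - h y) where
  periodic i y := by simp only [hu.periodic i y, hv.periodic i y]
  periodic_grad i y := by simp only [hu.periodic_grad i y, hv.periodic_grad i y]
  memLp := hu.memLp.sub hv.memLp
  memLp_grad := hu.memLp_grad.sub hv.memLp_grad
  integral_by_parts φ hφ hper k := by
    have hd := memLp_torusMeasure_of_continuous (continuous_partialDeriv hφ k)
    have hc := memLp_torusMeasure_of_continuous hφ.continuous
    simp only [sub_mul, PiLp.sub_apply]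
    have h1 := integral_sub (hu.memLp.integrable_mul hd) (hv.memLp.integrable_mul hd)
    have h2 := integral_sub ((memLp_coord hu.memLp_grad k).integrable_mul hc)
      ((memLp_coord hv.memLp_grad k).integrable_mul hc)
    simp only [Pi.mul_apply] at h1 h2
    rw [h1, h2,
      hu.integral_by_parts φ hφ hper k, hv.integral_by_parts φ hφ hper k]
    ring

theorem hasTorusWeakGradient_const {d : ℕ} (c : ℝ) :
    HasTorusWeakGradient (fun _ : Eucl d => c) fun _ => 0 where
  periodic _ _ := rfl
  periodic_grad _ _ := rfl
  memLp := memLp_const c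
  memLp_grad := memLp_const 0
  integral_by_parts φ hφ hper k := by
    rw [integral_const_mul, integral_partialDeriv_eq_zero hφ hper]
    simp

theorem HasTorusWeakGradient.sub_const {d : ℕ} {u : Eucl d → ℝ} {g : Eucl d → Eucl d}
    (h : HasTorusWeakGradient u g) (c : ℝ) : HasTorusWeakGradient (fun y => u y - c) g := by
  simpa only [sub_zero] using h.sub (hasTorusWeakGradient_const c)

/-! ### The closed space of gradients -/

/-- Square integrable vector fields on the torus. -/
abbrev VectorL2 (d : ℕ) : Type := Lp (Eucl d) 2 (torusMeasure d)

/-- The continuous linear functional `(u, g) ↦ ∫ u ∂ₖφ + ∫ gₖ φ`, whose vanishing for all test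
functions expresses that `g` is the weak gradient of `u`. -/
noncomputable def ibpDefect {d : ℕ} (φ : Eucl d → ℝ) (hφ : ContDiff ℝ ((⊤ : ℕ∞) : WithTop ℕ∞) φ)
    (k : Fin d) : Lp ℝ 2 (torusMeasure d) × VectorL2 d →L[ℝ] ℝ :=
  (innerSL ℝ (memLp_torusMeasure_of_continuous (continuous_partialDeriv hφ k)).toLp).comp
      (ContinuousLinearMap.fst ℝ _ _) +
    (innerSL ℝ (memLp_torusMeasure_of_continuous
      (hφ.continuous.smul (continuous_const (y := stdVec k)))).toLp).comp
      (ContinuousLinearMap.snd ℝ _ _)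

theorem ibpDefect_apply {d : ℕ} {φ : Eucl d → ℝ} (hφ : ContDiff ℝ ((⊤ : ℕ∞) : WithTop ℕ∞) φ)
    (k : Fin d) {p : Lp ℝ 2 (torusMeasure d) × VectorL2 d} {u : Eucl d → ℝ} {g : Eucl d → Eucl d}
    (hu : p.1 =ᵐ[torusMeasure d] u) (hg : p.2 =ᵐ[torusMeasure d] g) :
    ibpDefect φ hφ k p = ∫ y, u y * partialDeriv k φ y ∂(torusMeasure d) +
      ∫ y, g y k * φ y ∂(torusMeasure d) := by
  simp only [ibpDefect, add_apply, ContinuousLinearMap.comp_apply,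
    ContinuousLinearMap.coe_fst', ContinuousLinearMap.coe_snd', innerSL_apply_apply, L2.inner_def]
  congr 1
  · refine integral_congr_ae ?_
    filter_upwards [hu, MemLp.coeFn_toLp (memLp_torusMeasure_of_continuous
      (continuous_partialDeriv hφ k))] with y h1 h2
    rw [h1, h2]
    simp
  · refine integral_congr_ae ?_
    filter_upwards [hg, MemLp.coeFn_toLp (memLp_torusMeasure_of_continuous
      (hφ.continuous.smul (continuous_const (y := stdVec k))))] with y h1 h2
    rw [h1, h2]
    simp [stdVec, inner_smul_left, EuclideanSpace.inner_single_left, mul_comm]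

/-- The pairs of a mean-free function and its weak gradient, as a subspace of `L²`. -/
noncomputable def weakGradientGraph (d : ℕ) :
    Submodule ℝ (Lp ℝ 2 (torusMeasure d) × VectorL2 d) :=
  LinearMap.ker ((innerSL ℝ (memLp_const (1 : ℝ) (μ := torusMeasure d) (p := 2)).toLp).comp
      (ContinuousLinearMap.fst ℝ _ (VectorL2 d))).toLinearMap ⊓
    ⨅ (φ : Eucl d → ℝ) (hφ : ContDiff ℝ ((⊤ : ℕ∞) : WithTop ℕ∞) φ) (_ : IsPeriodic φ) (k : Fin d),
      LinearMap.ker (ibpDefect φ hφ k).toLinearMap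

theorem isClosed_weakGradientGraph (d : ℕ) :
    IsClosed (weakGradientGraph d : Set (Lp ℝ 2 (torusMeasure d) × VectorL2 d)) := by
  simp only [weakGradientGraph, Submodule.coe_inf, Submodule.coe_iInf]
  refine (ContinuousLinearMap.isClosed_ker _).inter ?_
  exact isClosed_iInter fun _ => isClosed_iInter fun _ => isClosed_iInter fun _ =>
    isClosed_iInter fun _ => ContinuousLinearMap.isClosed_ker _

theorem mem_weakGradientGraph_iff {d : ℕ} {p : Lp ℝ 2 (torusMeasure d) × VectorL2 d}
    {u : Eucl d → ℝ} {g : Eucl d → Eucl d}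
    (hu : p.1 =ᵐ[torusMeasure d] u) (hg : p.2 =ᵐ[torusMeasure d] g)
    (hup : IsPeriodic u) (hgp : IsPeriodic g) :
    p ∈ weakGradientGraph d ↔ ∫ y, u y ∂(torusMeasure d) = 0 ∧ HasTorusWeakGradient u g := by
  have h1 : inner ℝ (memLp_const (1 : ℝ) (μ := torusMeasure d) (p := 2)).toLp p.1 =
      ∫ y, u y ∂(torusMeasure d) := by
    rw [L2.inner_def]
    refine integral_congr_ae ?_
    filter_upwards [hu, (memLp_const (1 : ℝ) (μ := torusMeasure d) (p := 2)).coeFn_toLp]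
      with y h1 h2
    rw [h1, h2]
    simp
  simp only [weakGradientGraph, Submodule.mem_inf, Submodule.mem_iInf, LinearMap.mem_ker,
    ContinuousLinearMap.coe_coe, ibpDefect_apply _ _ hu hg, ContinuousLinearMap.comp_apply,
    ContinuousLinearMap.coe_fst', innerSL_apply_apply, h1]
  refine and_congr_right fun _ => ⟨fun h => ⟨hup, hgp, ?_, ?_, ?_⟩, fun h φ hφ hper k => ?_⟩
  · exact (memLp_congr_ae hu).1 (Lp.memLp _)
  · exact (memLp_congr_ae hg).1 (Lp.memLp _)
  · exact fun φ hφ hper k => eq_neg_of_add_eq_zero_left (h φ hφ hper k)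
  · rw [h.integral_by_parts φ hφ hper k, neg_add_cancel]

/-- An `L²` class knows nothing outside the cube, so periodic representatives are made by composing
with `fractCube`. -/
theorem exists_of_mem_weakGradientGraph {d : ℕ} {p : Lp ℝ 2 (torusMeasure d) × VectorL2 d}
    (hp : p ∈ weakGradientGraph d) : ∃ u g, p.1 =ᵐ[torusMeasure d] u ∧ p.2 =ᵐ[torusMeasure d] g ∧
      ∫ y, u y ∂(torusMeasure d) = 0 ∧ HasTorusWeakGradient u g := by
  have hu := (comp_fractCube_ae_eq (p.1 : Eucl d → ℝ)).symm
  have hg := (comp_fractCube_ae_eq (p.2 : Eucl d → Eucl d)).symm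
  exact ⟨_, _, hu, hg, (mem_weakGradientGraph_iff hu hg (isPeriodic_comp_fractCube _)
    (isPeriodic_comp_fractCube _)).1 hp⟩

theorem norm_sq_eq_integral {d : ℕ} {E : Type*} [NormedAddCommGroup E] [InnerProductSpace ℝ E]
    {f : Lp E 2 (torusMeasure d)} {g : Eucl d → E} (hg : f =ᵐ[torusMeasure d] g) :
    ‖f‖ ^ 2 = ∫ y, ‖g y‖ ^ 2 ∂(torusMeasure d) := by
  rw [← real_inner_self_eq_norm_sq, L2.inner_def]
  refine integral_congr_ae ?_
  filter_upwards [hg] with y hy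
  rw [hy, real_inner_self_eq_norm_sq]

theorem norm_fst_le_of_mem_weakGradientGraph {d : ℕ} {p : Lp ℝ 2 (torusMeasure d) × VectorL2 d}
    (hp : p ∈ weakGradientGraph d) : ‖p.1‖ ≤ ‖p.2‖ := by
  obtain ⟨u, g, hu, hg, h0, h⟩ := exists_of_mem_weakGradientGraph hp
  refine le_of_sq_le_sq ?_ (norm_nonneg _)
  rw [norm_sq_eq_integral hu, norm_sq_eq_integral hg]
  simpa using h.poincare h0

/-- The `L²` vector fields that are weak gradients of functions on the torus. -/
noncomputable def gradientSpace (d : ℕ) : Submodule ℝ (VectorL2 d) :=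
  (weakGradientGraph d).map (LinearMap.snd ℝ _ _)

theorem mem_gradientSpace_iff {d : ℕ} {f : VectorL2 d} :
    f ∈ gradientSpace d ↔ ∃ u g, f =ᵐ[torusMeasure d] g ∧ HasTorusWeakGradient u g := by
  constructor
  · rintro ⟨p, hp, rfl⟩
    obtain ⟨u, g, -, hg, -, h⟩ := exists_of_mem_weakGradientGraph hp
    exact ⟨u, g, hg, h⟩
  · rintro ⟨u, g, hg, h⟩
    -- The graph contains mean-free functions only; subtracting the mean does not change the
    -- gradient.
    have h' := h.sub_const (∫ y, u y ∂(torusMeasure d))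
    refine ⟨(h'.memLp.toLp, f), ?_, rfl⟩
    refine (mem_weakGradientGraph_iff h'.memLp.coeFn_toLp hg h'.periodic h'.periodic_grad).2
      ⟨?_, h'⟩
    rw [integral_sub (h.memLp.integrable (by norm_num)) (integrable_const _)]
    simp

/-- By Poincaré, projecting the closed graph to its gradient component does not shrink norms (the
product norm is a maximum), and such a map on a complete space has closed range. -/
theorem isClosed_gradientSpace (d : ℕ) : IsClosed (gradientSpace d : Set (VectorL2 d)) := by
  have : CompleteSpace (weakGradientGraph d) := (isClosed_weakGradientGraph d).completeSpace_coe
  let f : weakGradientGraph d →L[ℝ] VectorL2 d :=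
    (ContinuousLinearMap.snd ℝ _ _).comp (weakGradientGraph d).subtypeL
  have hf : AntilipschitzWith 1 f := f.antilipschitz_of_bound fun p => by
    simpa [f, Prod.norm_def] using norm_fst_le_of_mem_weakGradientGraph p.2
  have := hf.isClosed_range f.uniformContinuous
  convert this using 1
  ext g
  simp [gradientSpace, f]

/-! ### Coercive variational problems in Hilbert space -/

section Hilbert

variable {H : Type*} [NormedAddCommGroup H] [InnerProductSpace ℝ H]

/-- Existence of solutions of coercive variational problems on a closed subspace. -/
theorem exists_inner_map_add_eq_zero [CompleteSpace H] (W : Submodule ℝ H)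
    (hW : IsClosed (W : Set H)) (T : H →L[ℝ] H) {r : ℝ} (hr : 0 < r)
    (hT : ∀ f, r * ‖f‖ ^ 2 ≤ inner ℝ (T f) f) (e : H) :
    ∃ g ∈ W, ∀ h ∈ W, inner ℝ (T (e + g)) h = 0 := by
  have : CompleteSpace W := hW.completeSpace_coe
  let B : W →L[ℝ] W →L[ℝ] ℝ :=
    (innerSL ℝ).comp (W.orthogonalProjectionOnto.comp (T.comp W.subtypeL))
  have hB : ∀ v w : W, B v w = inner ℝ (T v) (w : H) := fun v w => by
    simp [B]
  have hcoer : IsCoercive B := ⟨r, hr, fun v => by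
    rw [hB, mul_assoc, ← sq]
    exact hT v⟩
  -- Lax–Milgram on `W`: `g` represents the functional `h ↦ -⟪T e, h⟫`.
  let g := hcoer.continuousLinearEquivOfBilin.symm (-W.orthogonalProjectionOnto (T e))
  refine ⟨g, g.2, fun h hh => ?_⟩
  have := hcoer.continuousLinearEquivOfBilin_apply g ⟨h, hh⟩
  rw [ContinuousLinearEquiv.apply_symm_apply, hB, inner_neg_left,
    W.inner_orthogonalProjectionOnto_eq_of_mem_right] at this
  rw [map_add, inner_add_left, ← this, add_neg_cancel]

/-- The solution of a coercive variational problem is bounded by its data. -/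
theorem norm_le_of_inner_map_add_eq_zero {W : Submodule ℝ H} {T : H →L[ℝ] H} {r : ℝ} (hr : 0 < r)
    (hT : ∀ f, r * ‖f‖ ^ 2 ≤ inner ℝ (T f) f) {e g : H} (hg : g ∈ W)
    (h : ∀ h ∈ W, inner ℝ (T (e + g)) h = 0) : ‖g‖ ≤ ‖T e‖ / r := by
  -- Testing with `g` itself gives `r ‖g‖² ≤ -⟪T e, g⟫ ≤ ‖T e‖ ‖g‖`; one factor `‖g‖` is cancelled
  -- when it is nonzero.
  have h1 := h g hg
  rw [map_add, inner_add_left] at h1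
  have h2 := hT g
  have h3 := neg_le_of_abs_le (abs_real_inner_le_norm (T e) g)
  rcases (norm_nonneg g).eq_or_lt with h0 | h0
  · rw [← h0]; positivity
  · rw [le_div_iff₀ hr]
    refine le_of_mul_le_mul_right ?_ h0
    nlinarith

/-- Solutions of coercive variational problems depend continuously on the operator. -/
theorem norm_sub_le_of_inner_map_add_eq_zero {W : Submodule ℝ H} {T T' : H →L[ℝ] H} {r : ℝ}
    (hr : 0 < r) (hT : ∀ f, r * ‖f‖ ^ 2 ≤ inner ℝ (T f) f) {e g g' : H} (hg : g ∈ W) (hg' : g' ∈ W)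
    (h : ∀ h ∈ W, inner ℝ (T (e + g)) h = 0) (h' : ∀ h ∈ W, inner ℝ (T' (e + g')) h = 0) :
    ‖g - g'‖ ≤ ‖(T - T') (e + g')‖ / r := by
  -- The difference of the two equations is an equation for `g - g'` with operator `T`, to be tested
  -- with `g - g'`.
  have key : ∀ w ∈ W, inner ℝ (T (g - g')) w + inner ℝ ((T - T') (e + g')) w = 0 := by
    intro w hw
    have := h w hw
    rw [show e + g = (g - g') + (e + g') by abel, map_add, inner_add_left] at this
    rw [sub_apply, inner_sub_left, h' w hw, sub_zero, this]
  have h1 := key _ (W.sub_mem hg hg')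
  have h2 := hT (g - g')
  have h3 := neg_le_of_abs_le (abs_real_inner_le_norm ((T - T') (e + g')) (g - g'))
  rcases (norm_nonneg (g - g')).eq_or_lt with h0 | h0
  · rw [← h0]; positivity
  · rw [le_div_iff₀ hr]
    refine le_of_mul_le_mul_right ?_ h0
    nlinarith

end Hilbert

/-! ### Multiplication operators on vector fields -/

section Multiplication

variable {d : ℕ}

theorem memLp_clm_apply {M : Eucl d → Eucl d →L[ℝ] Eucl d} (hM : Continuous M) {c : ℝ}
    (hc : ∀ y, ‖M y‖ ≤ c) {f : Eucl d → Eucl d} (hf : MemLp f 2 (torusMeasure d)) :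
    MemLp (fun y => M y (f y)) 2 (torusMeasure d) := by
  refine hf.of_le_mul (c := c) ?_ (.of_forall fun y => (M y).le_of_opNorm_le (hc y) _)
  exact (ContinuousLinearMap.id ℝ (Eucl d →L[ℝ] Eucl d)).aestronglyMeasurable_comp₂
    hM.aestronglyMeasurable hf.aestronglyMeasurable

/-- Pointwise multiplication of vector fields by a bounded continuous field of operators. -/
noncomputable def mulOperator (M : Eucl d → Eucl d →L[ℝ] Eucl d) (hM : Continuous M) {c : ℝ}
    (hc : ∀ y, ‖M y‖ ≤ c) : VectorL2 d →L[ℝ] VectorL2 d :=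
  LinearMap.mkContinuous
    { toFun := fun f => (memLp_clm_apply hM hc (Lp.memLp f)).toLp
      map_add' := fun f g => by
        rw [← MemLp.toLp_add]
        refine MemLp.toLp_congr _ _ ?_
        filter_upwards [Lp.coeFn_add f g] with y hy
        rw [hy, Pi.add_apply, map_add, Pi.add_apply]
      map_smul' := fun a f => by
        rw [RingHom.id_apply, ← MemLp.toLp_const_smul]
        refine MemLp.toLp_congr _ _ ?_
        filter_upwards [Lp.coeFn_smul a f] with y hy
        rw [hy, Pi.smul_apply, map_smul, Pi.smul_apply] } c
    (fun f => Lp.norm_le_mul_norm_of_ae_le_mul (by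
      filter_upwards [MemLp.coeFn_toLp (memLp_clm_apply hM hc (Lp.memLp f))] with y hy
      simp only [LinearMap.coe_mk, AddHom.coe_mk, hy]
      exact (M y).le_of_opNorm_le (hc y) _))

variable {M M' : Eucl d → Eucl d →L[ℝ] Eucl d} (hM : Continuous M) (hM' : Continuous M')
  {c c' : ℝ} (hc : ∀ y, ‖M y‖ ≤ c) (hc' : ∀ y, ‖M' y‖ ≤ c')

theorem mulOperator_ae_eq {f : VectorL2 d} {g : Eucl d → Eucl d} (hg : f =ᵐ[torusMeasure d] g) :
    mulOperator M hM hc f =ᵐ[torusMeasure d] fun y => M y (g y) := by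
  filter_upwards [hg, MemLp.coeFn_toLp (memLp_clm_apply hM hc (Lp.memLp f))] with y h1 h2
  rw [← h1]
  exact h2

theorem inner_mulOperator {f h : VectorL2 d} {f' h' : Eucl d → Eucl d}
    (hf : f =ᵐ[torusMeasure d] f') (hh : h =ᵐ[torusMeasure d] h') :
    inner ℝ (mulOperator M hM hc f) h = ∫ y, inner ℝ (M y (f' y)) (h' y) ∂(torusMeasure d) := by
  rw [L2.inner_def]
  refine integral_congr_ae ?_
  filter_upwards [mulOperator_ae_eq hM hc hf, hh] with y h1 h2
  rw [h1, h2]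

theorem norm_mulOperator_apply_le (f : VectorL2 d) : ‖mulOperator M hM hc f‖ ≤ c * ‖f‖ :=
  Lp.norm_le_mul_norm_of_ae_le_mul (by
    filter_upwards [mulOperator_ae_eq hM hc (f := f) .rfl] with y hy
    rw [hy]
    exact (M y).le_of_opNorm_le (hc y) _)

theorem norm_mulOperator_sub_apply_le {ε : ℝ} (hε : ∀ y, ‖M y - M' y‖ ≤ ε) (f : VectorL2 d) :
    ‖(mulOperator M hM hc - mulOperator M' hM' hc') f‖ ≤ ε * ‖f‖ :=
  Lp.norm_le_mul_norm_of_ae_le_mul (by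
    filter_upwards [mulOperator_ae_eq hM hc (f := f) .rfl, mulOperator_ae_eq hM' hc' (f := f) .rfl,
      Lp.coeFn_sub (mulOperator M hM hc f) (mulOperator M' hM' hc' f)] with y h1 h2 h3
    rw [sub_apply, h3, Pi.sub_apply, h1, h2, ← sub_apply]
    exact (M y - M' y).le_of_opNorm_le (hε y) _)

theorem le_inner_mulOperator {r : ℝ} (hr : ∀ y ξ, r * ‖ξ‖ ^ 2 ≤ inner ℝ (M y ξ) ξ)
    (f : VectorL2 d) : r * ‖f‖ ^ 2 ≤ inner ℝ (mulOperator M hM hc f) f := by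
  rw [norm_sq_eq_integral (g := f) .rfl, inner_mulOperator hM hc .rfl .rfl, ← integral_const_mul]
  refine integral_mono ((Lp.memLp f).integrable_norm_pow (by norm_num) |>.const_mul r) ?_
    fun y => hr y _
  refine (L2.integrable_inner (𝕜 := ℝ) (mulOperator M hM hc f) f).congr ?_
  filter_upwards [mulOperator_ae_eq hM hc (f := f) .rfl] with y hy
  rw [hy]

end Multiplication

/-! ### Matrix norms and Lipschitz bounds on the domain -/

theorem norm_le_sum_abs {d : ℕ} (v : Eucl d) : ‖v‖ ≤ ∑ i, |v i| := by
  conv_lhs => rw [← (EuclideanSpace.basisFun (Fin d) ℝ).sum_repr v]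
  refine (norm_sum_le _ _).trans (Finset.sum_le_sum fun i _ => ?_)
  simp [norm_smul]

theorem abs_coord_le_norm {d : ℕ} (v : Eucl d) (i : Fin d) : |v i| ≤ ‖v‖ :=
  PiLp.norm_apply_le v i

theorem toEuclideanCLM_apply_coord {d : ℕ} (B : Mat d) (ξ : Eucl d) (i : Fin d) :
    Matrix.toEuclideanCLM (n := Fin d) (𝕜 := ℝ) B ξ i = ∑ j, B i j * ξ j := by
  simp [Matrix.ofLp_toEuclideanCLM, Matrix.mulVec, dotProduct]

theorem norm_toEuclideanCLM_le {d : ℕ} {B : Mat d} {q : ℝ} (hB : ∀ i j, |B i j| ≤ q) :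
    ‖Matrix.toEuclideanCLM (n := Fin d) (𝕜 := ℝ) B‖ ≤ d * d * |q| := by
  refine ContinuousLinearMap.opNorm_le_bound _ (by positivity) fun ξ => ?_
  refine (norm_le_sum_abs _).trans ?_
  calc ∑ i, |Matrix.toEuclideanCLM (n := Fin d) (𝕜 := ℝ) B ξ i|
      ≤ ∑ _i : Fin d, ∑ _j : Fin d, |q| * ‖ξ‖ := by
        refine Finset.sum_le_sum fun i _ => ?_
        rw [toEuclideanCLM_apply_coord]
        refine (Finset.abs_sum_le_sum_abs _ _).trans (Finset.sum_le_sum fun j _ => ?_)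
        rw [abs_mul]
        exact mul_le_mul ((hB i j).trans (le_abs_self q)) (abs_coord_le_norm ξ j) (abs_nonneg _)
          (abs_nonneg _)
    _ = d * d * |q| * ‖ξ‖ := by simp; ring

theorem continuous_toEuclideanCLM {d : ℕ} :
    Continuous (Matrix.toEuclideanCLM (n := Fin d) (𝕜 := ℝ)) :=
  LinearMap.continuous_of_finiteDimensional
    (Matrix.toEuclideanCLM (n := Fin d) (𝕜 := ℝ)).toAlgEquiv.toLinearMap

theorem norm_fderiv_le_of_partialDeriv {d : ℕ} {f : Eucl d → ℝ} {x : Eucl d} {Q : ℝ}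
    (hf : DifferentiableAt ℝ f x) (hQ : ∀ k, |partialDeriv k f x| ≤ Q) :
    ‖fderiv ℝ f x‖ ≤ d * |Q| := by
  refine ContinuousLinearMap.opNorm_le_bound _ (by positivity) fun ξ => ?_
  conv_lhs => rw [← (EuclideanSpace.basisFun (Fin d) ℝ).sum_repr ξ]
  rw [map_sum]
  calc _ ≤ ∑ _i : Fin d, |Q| * ‖ξ‖ := by
        refine (norm_sum_le _ _).trans (Finset.sum_le_sum fun i _ => ?_)
        have h1 : fderiv ℝ f x (EuclideanSpace.basisFun (Fin d) ℝ i) = partialDeriv i f x := by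
          rw [partialDeriv, hf.lineDeriv_eq_fderiv, stdVec, EuclideanSpace.basisFun_apply]
        rw [map_smul, h1, norm_smul, mul_comm |Q|]
        exact mul_le_mul (abs_coord_le_norm ξ i) ((hQ i).trans (le_abs_self Q)) (abs_nonneg _)
          (norm_nonneg _)
    _ = d * |Q| * ‖ξ‖ := by simp; ring

/-- A bound on the derivative of a function controls its variation along a Lipschitz curve. -/
theorem abs_sub_le_of_norm_fderiv_le_of_curve {E : Type*} [NormedAddCommGroup E] [NormedSpace ℝ E]
    {Ω : Set E} (hΩ : IsOpen Ω) {f : E → ℝ} (hf : DifferentiableOn ℝ f Ω) {C : ℝ}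
    (hC : ∀ x ∈ Ω, ‖fderiv ℝ f x‖ ≤ C) {γ : ℝ → E} (hγ : Set.MapsTo γ (Set.Icc 0 1) Ω)
    {L : ℝ≥0} (hL : LipschitzOnWith L γ (Set.Icc 0 1)) :
    |f (γ 1) - f (γ 0)| ≤ C * L := by
  have hC0 : 0 ≤ C := (norm_nonneg _).trans (hC _ (hγ (Set.left_mem_Icc.2 zero_le_one)))
  -- Continuous induction on `[0,1]`: the mean value inequality needs convexity, so it is used only
  -- on small balls inside `Ω` around points of the curve.
  let S : Set ℝ := {t | |f (γ t) - f (γ 0)| ≤ C * L * t}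
  have hcont : ContinuousOn (fun t => |f (γ t) - f (γ 0)|) (Set.Icc 0 1) :=
    ((hf.continuousOn.comp hL.continuousOn hγ).sub continuousOn_const).abs
  have hclosed : IsClosed (S ∩ Set.Icc 0 1) := by
    rw [Set.inter_comm]
    exact isClosed_Icc.isClosed_le hcont (continuous_const.mul continuous_id).continuousOn
  have hsub : Set.Icc (0 : ℝ) 1 ⊆ S := by
    refine hclosed.Icc_subset_of_forall_exists_gt (by simp [S]) ?_
    rintro t ⟨htS, ht⟩ b hb
    have htI := Set.Ico_subset_Icc_self ht
    obtain ⟨ε, hε, hball⟩ := Metric.isOpen_iff.1 hΩ _ (hγ htI)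
    -- The last bound keeps `γ s` within `ε` of `γ t`; `L + 1` avoids dividing by zero.
    let s := min (min b 1) (t + ε / (2 * (L + 1)))
    have hL1 : (0 : ℝ) < L + 1 := by positivity
    have hts : t < s := lt_min (lt_min hb ht.2) (by have : 0 < ε / (2 * (L + 1)) := by positivity
                                                    linarith)
    have hs1 : s ≤ 1 := (min_le_left _ _).trans (min_le_right _ _)
    have hsI : s ∈ Set.Icc (0 : ℝ) 1 := ⟨ht.1.trans hts.le, hs1⟩
    have hdist : ‖γ s - γ t‖ ≤ L * (s - t) := by
      have := hL.dist_le_mul s hsI t htI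
      rwa [dist_eq_norm, Real.dist_eq, abs_of_pos (sub_pos.2 hts)] at this
    have hlt : ‖γ s - γ t‖ < ε := by
      have h1 : s - t ≤ ε / (2 * (L + 1)) := by
        have : s ≤ t + ε / (2 * (L + 1)) := min_le_right _ _
        linarith
      have h2 : (L + 1 : ℝ) * (ε / (2 * (L + 1))) = ε / 2 := by field_simp
      nlinarith [sub_pos.2 hts]
    have hmv := (convex_ball (γ t) ε).norm_image_sub_le_of_norm_fderiv_le (𝕜 := ℝ)
      (fun x hx => (hf x (hball hx)).differentiableAt (hΩ.mem_nhds (hball hx)))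
      (fun x hx => hC x (hball hx)) (Metric.mem_ball_self hε)
      (show γ s ∈ Metric.ball (γ t) ε by rwa [mem_ball_iff_norm])
    refine ⟨s, ?_, hts, (min_le_left _ _).trans (min_le_left _ _)⟩
    have htS' : |f (γ t) - f (γ 0)| ≤ C * L * t := htS
    calc |f (γ s) - f (γ 0)| ≤ |f (γ s) - f (γ t)| + |f (γ t) - f (γ 0)| := abs_sub_le _ _ _
      _ ≤ C * (L * (s - t)) + C * L * t :=
        add_le_add (hmv.trans (mul_le_mul_of_nonneg_left hdist hC0)) htS'
      _ = C * L * s := by ring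
  simpa [S] using hsub (Set.right_mem_Icc.2 zero_le_one)

/-- Bounded functions with bounded derivative on a uniformly locally quasiconvex open set are
Lipschitz, with a constant depending only on the bounds and the set. -/
theorem IsUniformlyLocallyQuasiconvex.exists_lipschitz {d : ℕ} {Ω : Set (Eucl d)}
    (hΩ : IsUniformlyLocallyQuasiconvex Ω) (hΩo : IsOpen Ω) (Q : ℝ) :
    ∃ C : ℝ, 0 ≤ C ∧ ∀ f : Eucl d → ℝ, DifferentiableOn ℝ f Ω → (∀ x ∈ Ω, |f x| ≤ Q) →
      (∀ x ∈ Ω, ∀ k, |partialDeriv k f x| ≤ Q) → ∀ x ∈ Ω, ∀ x' ∈ Ω,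
        |f x - f x'| ≤ C * ‖x - x'‖ := by
  obtain ⟨δ, hδ, K, hK⟩ := hΩ
  -- The first term serves points closer than `δ`, joined by a curve. For the others `|f x - f x'| ≤
  -- 2|Q| ≤ (2|Q|/δ) ‖x - x'‖`.
  refine ⟨d * |Q| * K + 2 * |Q| / δ, by positivity, fun f hf hb hd x hx x' hx' => ?_⟩
  rw [add_mul]
  rcases lt_or_ge (dist x' x) δ with h | h
  · obtain ⟨γ, h0, h1, hm, hl⟩ := hK x' hx' x hx h
    have := abs_sub_le_of_norm_fderiv_le_of_curve hΩo hf (fun y hy =>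
      norm_fderiv_le_of_partialDeriv (hf.differentiableAt (hΩo.mem_nhds hy)) (hd y hy)) hm hl
    rw [h0, h1, NNReal.coe_mul, coe_nndist, dist_comm, dist_eq_norm, ← mul_assoc] at this
    exact this.trans (le_add_of_nonneg_right (by positivity))
  · refine le_add_of_nonneg_of_le (by positivity) ?_
    have h2 : |f x - f x'| ≤ 2 * |Q| := by
      have := abs_sub (f x) (f x')
      have := hb x hx
      have := hb x' hx'
      have := le_abs_self Q
      linarith
    rw [dist_comm, dist_eq_norm] at h
    refine h2.trans ?_
    rw [div_mul_eq_mul_div, le_div_iff₀ hδ]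
    exact mul_le_mul_of_nonneg_left h (by positivity)

/-! ### The cell problem as a variational problem -/

variable {d : ℕ}

/-- The constant unit vector field in the direction of the `l`-th coordinate. -/
noncomputable def constField (l : Fin d) : VectorL2 d :=
  (memLp_const (stdVec l) (μ := torusMeasure d) (p := 2)).toLp

theorem constField_ae_eq (l : Fin d) :
    constField l =ᵐ[torusMeasure d] fun _ => stdVec l :=
  MemLp.coeFn_toLp _

theorem norm_constField (l : Fin d) : ‖constField l‖ = 1 := by
  rw [← sq_eq_sq₀ (norm_nonneg _) zero_le_one, norm_sq_eq_integral (constField_ae_eq l)]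
  simp [stdVec]

theorem inner_toEuclideanCLM (B : Mat d) (ξ η : Eucl d) :
    inner ℝ (Matrix.toEuclideanCLM (n := Fin d) (𝕜 := ℝ) B ξ) η =
      ∑ i, ∑ k, B i k * ξ k * η i := by
  rw [PiLp.inner_apply]
  refine Finset.sum_congr rfl fun i _ => ?_
  rw [toEuclideanCLM_apply_coord, ← Finset.sum_mul]
  simp [mul_comm]

theorem inner_toEuclideanCLM_stdVec (B : Mat d) (l : Fin d) (η : Eucl d) :
    inner ℝ (Matrix.toEuclideanCLM (n := Fin d) (𝕜 := ℝ) B (stdVec l)) η =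
      ∑ i, B i l * η i := by
  rw [inner_toEuclideanCLM]
  refine Finset.sum_congr rfl fun i _ => ?_
  simp [stdVec, PiLp.single_apply]

section Coefficient

variable {B B' : Eucl d → Mat d} {Q : ℝ} (hB : Continuous B) (hB' : Continuous B')
  (hQ : ∀ y i j, |B y i j| ≤ Q) (hQ' : ∀ y i j, |B' y i j| ≤ Q)

/-- Multiplication of vector fields by a bounded continuous matrix field. -/
noncomputable def coeffOperator : VectorL2 d →L[ℝ] VectorL2 d :=
  mulOperator (fun y => Matrix.toEuclideanCLM (n := Fin d) (𝕜 := ℝ) (B y))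
    (continuous_toEuclideanCLM.comp hB) fun y => norm_toEuclideanCLM_le (hQ y)

theorem inner_coeffOperator_constField_add (l : Fin d) {g h : VectorL2 d} {g' h' : Eucl d → Eucl d}
    (hg : g =ᵐ[torusMeasure d] g') (hh : h =ᵐ[torusMeasure d] h') :
    inner ℝ (coeffOperator hB hQ (constField l + g)) h =
      ∫ y, (∑ i, B y i l * h' y i) ∂(torusMeasure d) +
        ∫ y, (∑ i, ∑ k, B y i k * g' y k * h' y i) ∂(torusMeasure d) := by
  rw [map_add, inner_add_left, coeffOperator, inner_mulOperator _ _ (constField_ae_eq l) hh,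
    inner_mulOperator _ _ hg hh]
  simp only [inner_toEuclideanCLM_stdVec]
  simp only [inner_toEuclideanCLM]

/-- The bridge to the Hilbert space setting: column `l` of `B` is `B e_l`, so both sides of the weak
form merge into one orthogonality relation. -/
theorem isCorrector_iff {χ : Fin d → Eucl d → ℝ} {G : Fin d → Eucl d → Eucl d}
    {g : Fin d → VectorL2 d} (hg : ∀ l, g l =ᵐ[torusMeasure d] G l) :
    IsCorrector B χ G ↔ (∀ l, HasTorusWeakGradient (χ l) (G l)) ∧
      ∀ l, ∀ h ∈ gradientSpace d, inner ℝ (coeffOperator hB hQ (constField l + g l)) h = 0 := by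
  constructor
  · refine fun H => ⟨H.weakGradient, fun l h hh => ?_⟩
    obtain ⟨v, h', hh', hv⟩ := mem_gradientSpace_iff.1 hh
    rw [inner_coeffOperator_constField_add hB hQ l (hg l) hh', H.weakForm l v h' hv,
      add_neg_cancel]
  · refine fun H => ⟨H.1, fun l v h hv => ?_⟩
    have hh := hv.memLp_grad.coeFn_toLp
    have := H.2 l _ (mem_gradientSpace_iff.2 ⟨v, h, hh, hv⟩)
    rw [inner_coeffOperator_constField_add hB hQ l (hg l) hh] at this
    exact eq_neg_of_add_eq_zero_right this

theorem IsCorrector.memLp {χ : Fin d → Eucl d → ℝ} {G : Fin d → Eucl d → Eucl d}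
    (h : IsCorrector B χ G) (l : Fin d) : MemLp (G l) 2 (torusMeasure d) :=
  (h.weakGradient l).memLp_grad

theorem IsCorrector.toLp_mem {χ : Fin d → Eucl d → ℝ} {G : Fin d → Eucl d → Eucl d}
    (h : IsCorrector B χ G) (l : Fin d) : (h.memLp l).toLp ∈ gradientSpace d :=
  mem_gradientSpace_iff.2 ⟨_, _, (h.memLp l).coeFn_toLp, h.weakGradient l⟩

theorem IsCorrector.inner_eq_zero {χ : Fin d → Eucl d → ℝ} {G : Fin d → Eucl d → Eucl d}
    (h : IsCorrector B χ G) (l : Fin d) :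
    ∀ w ∈ gradientSpace d,
      inner ℝ (coeffOperator hB hQ (constField l + (h.memLp l).toLp)) w = 0 :=
  ((isCorrector_iff hB hQ fun l => (h.memLp l).coeFn_toLp).1 h).2 l

theorem le_inner_coeffOperator {r : ℝ} (hell : ∀ y ξ : Eucl d,
    r * ‖ξ‖ ^ 2 ≤ inner ℝ (Matrix.toEuclideanCLM (n := Fin d) (𝕜 := ℝ) (B y) ξ) ξ)
    (f : VectorL2 d) : r * ‖f‖ ^ 2 ≤ inner ℝ (coeffOperator hB hQ f) f :=
  le_inner_mulOperator _ _ hell f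

theorem norm_coeffOperator_apply_le (hQ0 : 0 ≤ Q) (f : VectorL2 d) :
    ‖coeffOperator hB hQ f‖ ≤ d * d * Q * ‖f‖ := by
  refine (norm_mulOperator_apply_le (continuous_toEuclideanCLM.comp hB)
    (fun y => norm_toEuclideanCLM_le (hQ y)) f).trans_eq ?_
  rw [abs_of_nonneg hQ0]

theorem norm_coeffOperator_sub_apply_le {ε : ℝ} (hε0 : 0 ≤ ε)
    (hε : ∀ y i j, |B y i j - B' y i j| ≤ ε) (f : VectorL2 d) :
    ‖(coeffOperator hB hQ - coeffOperator hB' hQ') f‖ ≤ d * d * ε * ‖f‖ := by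
  refine norm_mulOperator_sub_apply_le _ _ _ _ (fun y => ?_) f
  rw [← map_sub, ← abs_of_nonneg hε0]
  refine norm_toEuclideanCLM_le fun i j => ?_
  simpa using hε y i j

/-- The cell problem of a bounded continuous elliptic matrix field is solvable. -/
theorem exists_isCorrector {r : ℝ} (hr : 0 < r) (hB : Continuous B)
    (hQ : ∀ y i j, |B y i j| ≤ Q) (hell : ∀ y ξ : Eucl d,
      r * ‖ξ‖ ^ 2 ≤ inner ℝ (Matrix.toEuclideanCLM (n := Fin d) (𝕜 := ℝ) (B y) ξ) ξ) :
    ∃ χ G, IsCorrector B χ G := by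
  choose g hg hinner using fun l : Fin d => exists_inner_map_add_eq_zero (gradientSpace d)
    (isClosed_gradientSpace d) (coeffOperator hB hQ) hr
    (le_inner_coeffOperator hB hQ hell) (constField l)
  choose χ G hG hχ using fun l => mem_gradientSpace_iff.1 (hg l)
  exact ⟨χ, G, (isCorrector_iff hB hQ hG).2 ⟨hχ, hinner⟩⟩

theorem IsCorrector.norm_constField_add_le {r : ℝ} (hr : 0 < r) (hQ0 : 0 ≤ Q) (hB : Continuous B)
    (hQ : ∀ y i j, |B y i j| ≤ Q) (hell : ∀ y ξ : Eucl d,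
      r * ‖ξ‖ ^ 2 ≤ inner ℝ (Matrix.toEuclideanCLM (n := Fin d) (𝕜 := ℝ) (B y) ξ) ξ)
    {χ : Fin d → Eucl d → ℝ} {G : Fin d → Eucl d → Eucl d} (h : IsCorrector B χ G) (l : Fin d) :
    ‖constField l + (h.memLp l).toLp‖ ≤ 1 + d * d * Q / r := by
  refine (norm_add_le _ _).trans ?_
  rw [norm_constField]
  refine add_le_add_right ((norm_le_of_inner_map_add_eq_zero hr
    (le_inner_coeffOperator hB hQ hell) (h.toLp_mem l) (h.inner_eq_zero hB hQ l)).trans ?_) 1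
  have := norm_coeffOperator_apply_le hB hQ hQ0 (constField l)
  rw [norm_constField, mul_one] at this
  gcongr

/-- Gradients of correctors depend Lipschitz continuously on the coefficients. -/
theorem IsCorrector.norm_toLp_sub_le {r : ℝ} (hr : 0 < r) (hQ0 : 0 ≤ Q) (hB : Continuous B)
    (hB' : Continuous B') (hQ : ∀ y i j, |B y i j| ≤ Q) (hQ' : ∀ y i j, |B' y i j| ≤ Q)
    (hell : ∀ y ξ : Eucl d,
      r * ‖ξ‖ ^ 2 ≤ inner ℝ (Matrix.toEuclideanCLM (n := Fin d) (𝕜 := ℝ) (B y) ξ) ξ)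
    (hell' : ∀ y ξ : Eucl d,
      r * ‖ξ‖ ^ 2 ≤ inner ℝ (Matrix.toEuclideanCLM (n := Fin d) (𝕜 := ℝ) (B' y) ξ) ξ)
    {ε : ℝ} (hε0 : 0 ≤ ε) (hε : ∀ y i j, |B y i j - B' y i j| ≤ ε)
    {χ χ' : Fin d → Eucl d → ℝ} {G G' : Fin d → Eucl d → Eucl d} (h : IsCorrector B χ G)
    (h' : IsCorrector B' χ' G') (l : Fin d) :
    ‖(h.memLp l).toLp - (h'.memLp l).toLp‖ ≤ d * d * ε * (1 + d * d * Q / r) / r := by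
  refine (norm_sub_le_of_inner_map_add_eq_zero hr (le_inner_coeffOperator hB hQ hell)
    (h.toLp_mem l) (h'.toLp_mem l) (h.inner_eq_zero hB hQ l) (h'.inner_eq_zero hB' hQ' l)).trans ?_
  have h1 := norm_coeffOperator_sub_apply_le hB hB' hQ hQ' hε0 hε
    (constField l + (h'.memLp l).toLp)
  have h2 := h'.norm_constField_add_le hr hQ0 hB' hQ' hell' l
  gcongr
  exact h1.trans (by gcongr)

/-- Column `j` of `B + B ∇χᵀ` is `B (e_j + ∇χ_j)`, since the transpose puts `∇χ_j` in column `j`. -/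
theorem integral_effective_entry {χ : Fin d → Eucl d → ℝ} {G : Fin d → Eucl d → Eucl d}
    (h : IsCorrector B χ G) (i j : Fin d) :
    ∫ y, (B y + B y * (jacobian G y).transpose) i j ∂(torusMeasure d) =
      inner ℝ (coeffOperator hB hQ (constField j + (h.memLp j).toLp)) (constField i) := by
  have hae : ((constField j + (h.memLp j).toLp : VectorL2 d) : Eucl d → Eucl d)
      =ᵐ[torusMeasure d] fun y => stdVec j + G j y := by
    filter_upwards [Lp.coeFn_add (constField j) (h.memLp j).toLp, constField_ae_eq j,
      (h.memLp j).coeFn_toLp] with y h1 h2 h3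
    rw [h1, Pi.add_apply, h2, h3]
  rw [coeffOperator, inner_mulOperator _ _ hae (constField_ae_eq i)]
  refine integral_congr_ae (.of_forall fun y => ?_)
  simp only [stdVec, EuclideanSpace.inner_single_right, toEuclideanCLM_apply_coord]
  simp [Matrix.mul_apply, jacobian, mul_add, Finset.sum_add_distrib, PiLp.single_apply]

/-- The homogenized matrices of two matrix fields with given correctors are close entrywise if the
matrix fields are. -/
theorem IsCorrector.abs_effective_sub_le {r : ℝ} (hr : 0 < r) (hQ0 : 0 ≤ Q) (hB : Continuous B)
    (hB' : Continuous B') (hQ : ∀ y i j, |B y i j| ≤ Q) (hQ' : ∀ y i j, |B' y i j| ≤ Q)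
    (hell : ∀ y ξ : Eucl d,
      r * ‖ξ‖ ^ 2 ≤ inner ℝ (Matrix.toEuclideanCLM (n := Fin d) (𝕜 := ℝ) (B y) ξ) ξ)
    (hell' : ∀ y ξ : Eucl d,
      r * ‖ξ‖ ^ 2 ≤ inner ℝ (Matrix.toEuclideanCLM (n := Fin d) (𝕜 := ℝ) (B' y) ξ) ξ)
    {ε : ℝ} (hε0 : 0 ≤ ε) (hε : ∀ y i j, |B y i j - B' y i j| ≤ ε)
    {χ χ' : Fin d → Eucl d → ℝ} {G G' : Fin d → Eucl d → Eucl d} (h : IsCorrector B χ G)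
    (h' : IsCorrector B' χ' G') (i j : Fin d) :
    |∫ y, (B y + B y * (jacobian G y).transpose) i j ∂(torusMeasure d) -
      ∫ y, (B' y + B' y * (jacobian G' y).transpose) i j ∂(torusMeasure d)| ≤
      d * d * ε * (1 + d * d * Q / r) ^ 2 := by
  rw [integral_effective_entry hB hQ h, integral_effective_entry hB' hQ' h', ← inner_sub_left]
  refine (abs_real_inner_le_norm _ _).trans ?_
  rw [norm_constField, mul_one]
  have h1 := norm_coeffOperator_sub_apply_le hB hB' hQ hQ' hε0 hε
    (constField j + (h'.memLp j).toLp)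
  have h2 := h'.norm_constField_add_le hr hQ0 hB' hQ' hell' j
  have h3 := norm_coeffOperator_apply_le hB hQ hQ0 ((h.memLp j).toLp - (h'.memLp j).toLp)
  have h4 := h.norm_toLp_sub_le hr hQ0 hB hB' hQ hQ' hell hell' hε0 hε h' j
  -- The change of the flux splits into the change of the operator and the change of the corrector.
  -- With `q = d²Q/r` the two bounds add up to `d²ε(1 + q) + d²ε q(1 + q) = d²ε(1 + q)²`.
  have hsplit : coeffOperator hB hQ (constField j + (h.memLp j).toLp) -
      coeffOperator hB' hQ' (constField j + (h'.memLp j).toLp) =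
      (coeffOperator hB hQ - coeffOperator hB' hQ') (constField j + (h'.memLp j).toLp) +
        coeffOperator hB hQ ((h.memLp j).toLp - (h'.memLp j).toLp) := by
    rw [sub_apply, map_sub, map_add, map_add, map_add]
    abel
  rw [hsplit]
  calc _ ≤ d * d * ε * (1 + d * d * Q / r) +
        d * d * Q * (d * d * ε * (1 + d * d * Q / r) / r) :=
        (norm_add_le _ _).trans (add_le_add (h1.trans (by gcongr)) (h3.trans (by gcongr)))
    _ = _ := by ring

end Coefficient

/-! ### Admissible coefficients and conclusion -/

namespace IsAdmissibleCoefficient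

variable {Ω : Set (Eucl d)} {r Q : ℝ} {A : Eucl d → Eucl d → Mat d}

theorem continuous_apply (hA : IsAdmissibleCoefficient Ω r Q A) {x : Eucl d} (hx : x ∈ Ω) :
    Continuous (A x) :=
  continuous_matrix fun i j => (hA.contDiff i j).continuousOn.comp_continuous
    (f := fun y => (x, y)) (by fun_prop) fun _ => ⟨hx, Set.mem_univ _⟩

theorem differentiableOn_entry (hA : IsAdmissibleCoefficient Ω r Q A) (y : Eucl d) (i j : Fin d) :
    DifferentiableOn ℝ (fun x => A x y i j) Ω :=
  ((hA.contDiff i j).differentiableOn (by simp)).comp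
    (f := fun x => (x, y)) (by fun_prop) fun _ hx => ⟨hx, Set.mem_univ _⟩

theorem exists_isCorrector (hA : IsAdmissibleCoefficient Ω r Q A) (hr : 0 < r) {x : Eucl d}
    (hx : x ∈ Ω) : ∃ χ G, IsCorrector (A x) χ G :=
  Homogenization.exists_isCorrector hr (hA.continuous_apply hx) (hA.bound x hx) (hA.elliptic x hx)

theorem isCorrector_correctorGradient (hA : IsAdmissibleCoefficient Ω r Q A) (hr : 0 < r)
    {x : Eucl d} (hx : x ∈ Ω) : ∃ χ, IsCorrector (A x) χ (correctorGradient (A x)) := by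
  have h : ∃ G : Fin d → Eucl d → Eucl d, ∃ χ, IsCorrector (A x) χ G := by
    obtain ⟨χ, G, h⟩ := hA.exists_isCorrector hr hx
    exact ⟨G, χ, h⟩
  rw [correctorGradient, dif_pos h]
  exact h.choose_spec

end IsAdmissibleCoefficient

end Homogenization

theorem mainTheorem5 (d : ℕ) (Ω : Set (Homogenization.Eucl d)) (hΩ_open : IsOpen Ω)
    (hΩ_bdd : Bornology.IsBounded Ω) (hΩ : Homogenization.IsUniformlyLocallyQuasiconvex Ω)
    (r Q : ℝ) (hr : 0 < r) (hQ : 0 < Q) :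
    ∃ C : ℝ, ∀ A : Homogenization.Eucl d → Homogenization.Eucl d → Homogenization.Mat d,
      Homogenization.IsAdmissibleCoefficient Ω r Q A →
        -- the cell problem is solvable at each point of the domain
        (∀ x ∈ Ω, ∃ χ G, Homogenization.IsCorrector (A x) χ G) ∧
        -- the correctors are Lipschitz in `x` in the gradient seminorm; in particular (take equal
        -- points) the gradient of the corrector, hence the homogenized tensor, is well defined
        (∀ x ∈ Ω, ∀ x' ∈ Ω, ∀ χ G χ' G', Homogenization.IsCorrector (A x) χ G →
          Homogenization.IsCorrector (A x') χ' G' → ∀ l,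
            MeasureTheory.eLpNorm (fun y => G l y - G' l y) 2 (Homogenization.torusMeasure d)
              ≤ ENNReal.ofReal (C * ‖x - x'‖)) ∧
        -- the homogenized tensor is Lipschitz in the spectral norm
        (∀ x ∈ Ω, ∀ x' ∈ Ω,
          Homogenization.matSpectralNorm
              (Homogenization.homogenizedTensor A x - Homogenization.homogenizedTensor A x')
            ≤ C * ‖x - x'‖) := by
  obtain ⟨C₀, hC₀, hlip⟩ := hΩ.exists_lipschitz hΩ_open Q
  have hε : ∀ A, Homogenization.IsAdmissibleCoefficient Ω r Q A → ∀ x ∈ Ω, ∀ x' ∈ Ω,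
      ∀ y i j, |A x y i j - A x' y i j| ≤ C₀ * ‖x - x'‖ := fun A hA x hx x' hx' y i j =>
    hlip _ (hA.differentiableOn_entry y i j) (fun z hz => hA.bound z hz y i j)
      (fun z hz k => hA.bound_dx z hz y i j k) x hx x' hx'
  have hC₁ : 0 ≤ d * d * C₀ * (1 + d * d * Q / r) / r := by positivity
  have hC₂ : 0 ≤ d * d * (d * d * C₀ * (1 + d * d * Q / r) ^ 2) := by positivity
  -- The sum of the constants for the correctors and for the tensor serves both claims; the outer `d
  -- * d` in the second passes from entries to the spectral norm.
  refine ⟨d * d * C₀ * (1 + d * d * Q / r) / r + d * d * (d * d * C₀ * (1 + d * d * Q / r) ^ 2),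
    fun A hA => ⟨fun x hx => hA.exists_isCorrector hr hx, ?_, ?_⟩⟩
  · intro x hx x' hx' χ G χ' G' h h' l
    have key := h.norm_toLp_sub_le hr hQ.le (hA.continuous_apply hx) (hA.continuous_apply hx')
      (hA.bound x hx) (hA.bound x' hx') (hA.elliptic x hx) (hA.elliptic x' hx')
      (by positivity) (hε A hA x hx x' hx') h' l
    rw [← MeasureTheory.MemLp.toLp_sub, MeasureTheory.Lp.norm_toLp] at key
    refine ENNReal.le_ofReal_iff_toReal_le ((h.memLp l).sub (h'.memLp l)).2.ne (by positivity)
      |>.2 (key.trans ?_)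
    rw [add_mul]
    refine le_add_of_le_of_nonneg (le_of_eq (by ring)) (by positivity)
  · intro x hx x' hx'
    obtain ⟨χ, h⟩ := hA.isCorrector_correctorGradient hr hx
    obtain ⟨χ', h'⟩ := hA.isCorrector_correctorGradient hr hx'
    refine (Homogenization.norm_toEuclideanCLM_le fun i j =>
      h.abs_effective_sub_le hr hQ.le (hA.continuous_apply hx) (hA.continuous_apply hx')
      (hA.bound x hx) (hA.bound x' hx') (hA.elliptic x hx) (hA.elliptic x' hx')
      (by positivity) (hε A hA x hx x' hx') h' i j).trans ?_
    rw [abs_of_nonneg (by positivity), add_mul]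
    refine le_add_of_nonneg_of_le (by positivity) (le_of_eq (by ring))
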